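/- Let $K$ be a field of characteristic $0$ with an automorphism $\sigma$, and let $A\in\mathrm{GL}_n(K)$. A difference ring is a commutative ring with an automorphism, again denoted $\sigma$. For a field $F$ with an automorphism $\tau$ put $C_F=\{a\in F:\tau(a)=a\}$ and $D_F=\{a\in F:\tau^m(a)=a\text{ for some }m\neq 0\}$. A Picard-Vessiot ring for $\sigma(X)=AX$ over $K$ is a nonzero difference ring extension $R$ of $K$ (the automorphism of $R$ extending that of $K$) of the form $R=K[Z,\det(Z)^{-1}]$ with $Z\in\mathrm{GL}_n(R)$, $\sigma(Z)=AZ$, such that the only ideals $I$ of $R$ with $\sigma(I)\subseteq I$ are $0$ and $R$. For such an $R$ there are an integer $\ell\ge 1$ and a prime ideal $P$ of $R$ with $\sigma^\ell(P)=P$ that is maximal among the proper ideals $J$ of $R$ with $\sigma^\ell(J)\subseteq J$, such that the canonical map $R\to\prod_{i=0}^{\ell-1}R/\sigma^i(P)$ is an isomorphism. For such $\ell$ and $P$, let $F$ be the field of fractions of $R/P$ with the automorphism $\tau$ induced by $\sigma^\ell$, so that $C_F$ and $D_F$ are formed with respect to $\tau$. The $m$-invariant of $R$ is $m(R)=\ell\cdot[D_F:D_KC_F]$,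 where $D_KC_F$ is the compositum in $F$ of $C_F$ and the image of $D_K$; it is a natural number, independent of the choice of $\ell$ and $P$. Proposition 4.9. If $C_K=D_K$, then all Picard-Vessiot rings for $\sigma(X)=AX$ over $K$ have the same Krull dimension and the same $m$-invariant. -/

import Mathlib

/-- `C_F`: the subfield of constants of a field `F` with automorphism `σ`. -/
def constantField {F : Type*} [Field F] (σ : F ≃+* F) : Subfield F where
  carrier := {a | σ a = a}
  mul_mem' {a b} ha hb := by
    simp only [Set.mem_ofPred_eq] at ha hb ⊢
    rw [map_mul, ha, hb]
  one_mem' := map_one σ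
  add_mem' {a b} ha hb := by
    simp only [Set.mem_ofPred_eq] at ha hb ⊢
    rw [map_add, ha, hb]
  zero_mem' := map_zero σ
  neg_mem' {a} ha := by
    simp only [Set.mem_ofPred_eq] at ha ⊢
    rw [map_neg, ha]
  inv_mem' a ha := by
    simp only [Set.mem_ofPred_eq] at ha ⊢
    rw [map_inv₀, ha]

theorem pow_mul_apply_of_fixed {F : Type*} [Field F] (σ : F ≃+* F) {m : ℕ} {a : F}
    (ha : (σ ^ m) a = a) (k : ℕ) : (σ ^ (m * k)) a = a := by
  induction k with
  | zero => simp
  | succ k ih => rw [Nat.mul_succ, pow_add, RingAut.mul_apply, ha, ih]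

/-- `D_F`: the subfield of those elements of `F` that are fixed by some nonzero power of `σ`. -/
def periodicField {F : Type*} [Field F] (σ : F ≃+* F) : Subfield F where
  carrier := {a | ∃ m : ℕ, m ≠ 0 ∧ (σ ^ m) a = a}
  mul_mem' := by
    rintro a b ⟨m, hm, ha⟩ ⟨k, hk, hb⟩
    refine ⟨m * k, mul_ne_zero hm hk, ?_⟩
    have hb' := pow_mul_apply_of_fixed σ hb m
    rw [mul_comm] at hb'
    rw [map_mul, pow_mul_apply_of_fixed σ ha k, hb']
  one_mem' := ⟨1, one_ne_zero, map_one _⟩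
  add_mem' := by
    rintro a b ⟨m, hm, ha⟩ ⟨k, hk, hb⟩
    refine ⟨m * k, mul_ne_zero hm hk, ?_⟩
    have hb' := pow_mul_apply_of_fixed σ hb m
    rw [mul_comm] at hb'
    rw [map_add, pow_mul_apply_of_fixed σ ha k, hb']
  zero_mem' := ⟨1, one_ne_zero, map_zero _⟩
  neg_mem' := by
    rintro a ⟨m, hm, ha⟩
    exact ⟨m, hm, by rw [map_neg, ha]⟩
  inv_mem' := by
    rintro a ⟨m, hm, ha⟩
    exact ⟨m, hm, by rw [map_inv₀, ha]⟩

/-- `(R, σ)` is a Picard-Vessiot ring for `σ(X) = AX` over the difference field `(K, σK)`: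
a difference ring extension of `K` generated by the entries of a fundamental solution matrix `Z`
and by `1 / det Z`, without `σ`-invariant ideals other than `0` and `R`. -/
structure IsPicardVessiotRing {K : Type*} [Field K] (σK : K ≃+* K) {n : ℕ}
    (A : Matrix.GeneralLinearGroup (Fin n) K)
    (R : Type*) [CommRing R] [Algebra K R] (σ : R ≃+* R) : Prop where
  nontrivial : Nontrivial R
  map_algebraMap : ∀ a : K, σ (algebraMap K R a) = algebraMap K R (σK a)
  exists_fundamental : ∃ Z : Matrix.GeneralLinearGroup (Fin n) R,
    (Z : Matrix (Fin n) (Fin n) R).map σ =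
      (A : Matrix (Fin n) (Fin n) K).map (algebraMap K R) * (Z : Matrix (Fin n) (Fin n) R) ∧
    Algebra.adjoin K
      (insert ((Z⁻¹ : Matrix.GeneralLinearGroup (Fin n) R).det : R)
        {z : R | ∃ i j, z = (Z : Matrix (Fin n) (Fin n) R) i j}) = ⊤
  simple : ∀ I : Ideal R, (∀ a ∈ I, σ a ∈ I) → I = ⊥ ∨ I = ⊤

/-- `P` is a prime ideal of `R` which is a maximal `σ^ℓ`-ideal (stable under `σ^ℓ`), and the
canonical map `R → R/P × R/σ(P) × ⋯ × R/σ^(ℓ-1)(P)` is an isomorphism. Hence `ℓ` is the number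
of primitive idempotents of `R`, and `R/P` is one of the domains of which `R` is the direct sum. -/
structure IsPrimeDecomposition {R : Type*} [CommRing R] (σ : R ≃+* R) (ℓ : ℕ) (P : Ideal R) :
    Prop where
  pos : 0 < ℓ
  isPrime : P.IsPrime
  stable : P = P.map ((σ ^ ℓ : R ≃+* R) : R →+* R)
  maximal : ∀ J : Ideal R, (∀ a ∈ J, (σ ^ ℓ) a ∈ J) → P ≤ J → J = P ∨ J = ⊤
  bijective : Function.Bijective
    (RingHom.pi fun i : Fin ℓ =>
      Ideal.Quotient.mk (P.map ((σ ^ (i : ℕ) : R ≃+* R) : R →+* R)))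

/-- The automorphism of the field of fractions of `R/P` induced by an automorphism `τ` of `R`
with `τ(P) = P`. -/
noncomputable def inducedAut {R : Type*} [CommRing R] (P : Ideal R) [P.IsPrime] (τ : R ≃+* R)
    (h : P = P.map (τ : R →+* R)) : FractionRing (R ⧸ P) ≃+* FractionRing (R ⧸ P) :=
  IsFractionRing.ringEquivOfRingEquiv (Ideal.quotientEquiv P P τ h)

/-- The degree `[D_F : D_K C_F]`, where `F` is a field extension of `K` and `τ` an automorphism
of `F`; here `D_K C_F` is the compositum, inside `F`, of (the image of) `D_K` and `C_F`. -/
noncomputable def periodicDegree {K : Type*} [Field K] (σK : K ≃+* K)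
    (F : Type*) [Field F] [Algebra K F] (τ : F ≃+* F) : Cardinal :=
  Subfield.relrank ((periodicField σK).map (algebraMap K F) ⊔ constantField τ) (periodicField τ)

/-- The `m`-invariant of `R` is (well defined and equal to) the natural number `m`: there is a
decomposition of `R` into domains as in `IsPrimeDecomposition`, and for each of them, with
`F = Frac(R/P)` regarded as a difference field by means of `σ^ℓ`, one has
`m = ℓ · [D_F : D_K C_F]`. -/
def HasMInvariant {K : Type*} [Field K] (σK : K ≃+* K)
    (R : Type*) [CommRing R] [Algebra K R] (σ : R ≃+* R) (m : ℕ) : Prop :=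
  (∃ (ℓ : ℕ) (P : Ideal R), IsPrimeDecomposition σ ℓ P) ∧
  ∀ (ℓ : ℕ) (P : Ideal R) (h : IsPrimeDecomposition σ ℓ P),
    haveI : P.IsPrime := h.isPrime
    (ℓ : Cardinal) *
      periodicDegree σK (FractionRing (R ⧸ P)) (inducedAut P (σ ^ ℓ) h.stable) = m

/-!
The tensor product over `K` of two Picard-Vessiot rings for the same equation has a simple
difference quotient `S`, which contains both of them. Over `S` the two fundamental matrices differ
by an invertible matrix of constants, so `S` is generated by constants over either ring. As `K` is
a field and `S` is finitely generated, constants of `S` are algebraic over `K`; hence `S` is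
integral over both rings and all three Krull dimensions agree.

For the `m`-invariant, write `R` as a product of `ℓ` copies of the domain `R/P`, permuted
cyclically by `σ`. When `C_K = D_K` this gives `m(R) = [D_R : C_R]`, the dimension over the field
of constants `C_R` of the periodic elements `D_R` of the ring `R` itself. This number does not
change on passing from `R` to `S`, because `S` has a basis of constants over `R`.
-/

section Constants

variable {R S : Type*} [CommRing R] [CommRing S] [Algebra R S] {σ : R ≃+* R} {τ : S ≃+* S}

/-- The subring of constants `C_R = {a | σ a = a}` of a difference ring `(R, σ)`; the counterpart of
`constantField` for rings that need not be fields. -/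
def constantSubring (σ : R ≃+* R) : Subring R :=
  RingHom.eqLocus (σ : R →+* R) (RingHom.id R)

theorem mem_constantSubring {a : R} : a ∈ constantSubring σ ↔ σ a = a := Iff.rfl

theorem pow_apply_of_fixed {a : R} (ha : σ a = a) (k : ℕ) : (σ ^ k) a = a :=
  pow_mem (show σ ∈ MulAction.stabilizer (RingAut R) a from ha) k

theorem pow_apply_of_dvd {a : R} {m k : ℕ} (ha : (σ ^ m) a = a) (h : m ∣ k) : (σ ^ k) a = a := by
  obtain ⟨l, rfl⟩ := h
  rw [pow_mul]
  exact pow_apply_of_fixed ha l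

/-- The periodic elements `D_R = {a | σ ^ m a = a for some m ≠ 0}` of a difference ring, as a module
over its constants; the counterpart of `periodicField` for rings that need not be fields. -/
def periodicSubmodule (σ : R ≃+* R) : Submodule (constantSubring σ) R where
  carrier := {a | ∃ m : ℕ, m ≠ 0 ∧ (σ ^ m) a = a}
  add_mem' := by
    rintro a b ⟨m, hm, ha⟩ ⟨k, hk, hb⟩
    refine ⟨m * k, mul_ne_zero hm hk, ?_⟩
    rw [map_add, pow_apply_of_dvd ha (dvd_mul_right m k), pow_apply_of_dvd hb (dvd_mul_left k m)]
  zero_mem' := ⟨1, one_ne_zero, map_zero _⟩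
  smul_mem' := by
    rintro ⟨c, hc⟩ a ⟨m, hm, ha⟩
    refine ⟨m, hm, ?_⟩
    rw [Subring.smul_def, smul_eq_mul, map_mul, ha, pow_apply_of_fixed hc]

theorem exists_common_period {ι : Type*} [Finite ι] {a : ι → R}
    (ha : ∀ i, a i ∈ periodicSubmodule σ) : ∃ m : ℕ, m ≠ 0 ∧ ∀ i, (σ ^ m) (a i) = a i := by
  have := Fintype.ofFinite ι
  choose m hm h using ha
  exact ⟨∏ i, m i, Finset.prod_ne_zero_iff.2 fun i _ => hm i,
    fun i => pow_apply_of_dvd (h i) (Finset.dvd_prod_of_mem m (Finset.mem_univ i))⟩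

/-- `(S, τ)` is a difference algebra over `(R, σ)`: the structure map commutes with the
automorphisms. -/
def IsDifferenceAlgebra (σ : R ≃+* R) (τ : S ≃+* S) : Prop :=
  ∀ r, τ (algebraMap R S r) = algebraMap R S (σ r)

namespace IsDifferenceAlgebra

protected theorem pow (h : IsDifferenceAlgebra σ τ) (k : ℕ) :
    IsDifferenceAlgebra (σ ^ k) (τ ^ k) := by
  induction k with
  | zero => exact fun _ => rfl
  | succ k ih =>
    intro r
    rw [pow_succ, pow_succ, RingAut.mul_apply, h, ih, RingAut.mul_apply]

protected theorem trans {K : Type*} [CommRing K] [Algebra K R] [Algebra K S] [IsScalarTower K R S]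
    {σK : K ≃+* K} (h : IsDifferenceAlgebra σK σ) (h' : IsDifferenceAlgebra σ τ) :
    IsDifferenceAlgebra σK τ := fun a => by
  rw [IsScalarTower.algebraMap_apply K R S, h', h, ← IsScalarTower.algebraMap_apply]

theorem algebraMap_mem_constantSubring (h : IsDifferenceAlgebra σ τ) {r : R}
    (hr : r ∈ constantSubring σ) : algebraMap R S r ∈ constantSubring τ :=
  (h r).trans (congrArg _ hr)

theorem algebraMap_mem_periodicSubmodule (h : IsDifferenceAlgebra σ τ) {r : R}
    (hr : r ∈ periodicSubmodule σ) : algebraMap R S r ∈ periodicSubmodule τ :=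
  let ⟨m, hm, hr⟩ := hr
  ⟨m, hm, (h.pow m r).trans (congrArg _ hr)⟩

theorem linearCombination_mapRange (h : IsDifferenceAlgebra σ τ) {J : Type*} {e : J → S}
    (he : ∀ j, τ (e j) = e j) (l : J →₀ R) :
    Finsupp.linearCombination R e (l.mapRange σ (map_zero σ)) =
      τ (Finsupp.linearCombination R e l) := by
  rw [Finsupp.linearCombination_apply, Finsupp.linearCombination_apply, map_finsuppSum,
    Finsupp.sum_mapRange_index (fun j => zero_smul R (e j))]
  refine Finsupp.sum_congr fun j _ => ?_
  rw [Algebra.smul_def, Algebra.smul_def, map_mul, he, h]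

end IsDifferenceAlgebra

end Constants

/-- A difference ring is simple if it is nonzero and has no difference ideals other than `0` and
itself. As for Picard-Vessiot rings, a difference ideal is only required to satisfy
`σ(I) ⊆ I`. -/
structure IsDifferenceSimple {R : Type*} [CommRing R] (σ : R ≃+* R) : Prop where
  nontrivial : Nontrivial R
  eq_bot_or_eq_top : ∀ I : Ideal R, (∀ a ∈ I, σ a ∈ I) → I = ⊥ ∨ I = ⊤

namespace IsDifferenceSimple

variable {R S : Type*} [CommRing R] [CommRing S] [Algebra R S] {σ : R ≃+* R} {τ : S ≃+* S}

theorem of_field {K : Type*} [Field K] (σ : K ≃+* K) : IsDifferenceSimple σ :=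
  ⟨inferInstance, fun I _ => Ideal.eq_bot_or_top I⟩

theorem eq_top (hσ : IsDifferenceSimple σ) {I : Ideal R} (hI : ∀ a ∈ I, σ a ∈ I) {a : R}
    (ha : a ∈ I) (ha0 : a ≠ 0) : I = ⊤ :=
  (hσ.eq_bot_or_eq_top I hI).resolve_left <| by
    rintro rfl
    exact ha0 ha

theorem isUnit_of_fixed (hσ : IsDifferenceSimple σ) {a : R} (ha : σ a = a) (ha0 : a ≠ 0) :
    IsUnit a := by
  rw [← Ideal.span_singleton_eq_top]
  refine hσ.eq_top (fun b hb => ?_) (Ideal.mem_span_singleton_self a) ha0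
  rw [Ideal.mem_span_singleton] at hb ⊢
  rw [← ha]
  exact map_dvd σ hb

theorem isField_constantSubring (hσ : IsDifferenceSimple σ) : IsField (constantSubring σ) where
  exists_pair_ne := by
    have := hσ.nontrivial
    exact ⟨0, 1, zero_ne_one⟩
  mul_comm := mul_comm
  mul_inv_cancel := by
    rintro ⟨a, ha⟩ ha0
    have hunit : IsUnit a := hσ.isUnit_of_fixed ha fun h => ha0 (Subtype.ext h)
    obtain ⟨b, hb⟩ := hunit.exists_right_inv
    refine ⟨⟨b, hunit.mul_left_cancel ?_⟩, Subtype.ext hb⟩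
    have hσb : a * σ b = 1 := by rw [← map_one σ, ← hb, map_mul, mem_constantSubring.1 ha]
    exact hσb.trans hb.symm

theorem injective_algebraMap [Nontrivial S] (hσ : IsDifferenceSimple σ)
    (h : IsDifferenceAlgebra σ τ) : Function.Injective (algebraMap R S) := by
  rw [RingHom.injective_iff_ker_eq_bot]
  refine (hσ.eq_bot_or_eq_top _ fun a ha => ?_).resolve_right (RingHom.ker_ne_top _)
  rw [RingHom.mem_ker] at ha ⊢
  rw [← h, ha, map_zero]

theorem exists_mem_apply_eq_one (hσ : IsDifferenceSimple σ) {J : Type*}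
    {N : Submodule R (J →₀ R)} (hN : ∀ l ∈ N, l.mapRange σ (map_zero σ) ∈ N) {l : J →₀ R}
    (hl : l ∈ N) {j : J} (hj : l j ≠ 0) : ∃ l' ∈ N, l' j = 1 := by
  have htop : N.map (Finsupp.lapply j) = ⊤ := by
    refine hσ.eq_top ?_ ⟨l, hl, rfl⟩ hj
    rintro _ ⟨l', hl', rfl⟩
    exact ⟨_, hN l' hl', Finsupp.mapRange_apply (hf := map_zero σ)⟩
  exact (htop ▸ Submodule.mem_top : (1 : R) ∈ N.map (Finsupp.lapply j))

theorem exists_fixed_mem_of_ne_bot (hσ : IsDifferenceSimple σ) {J : Type*}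
    {N : Submodule R (J →₀ R)} (hN : ∀ l ∈ N, l.mapRange σ (map_zero σ) ∈ N) (hN0 : N ≠ ⊥) :
    ∃ l ∈ N, l ≠ 0 ∧ ∀ j, σ (l j) = l j := by
  have := hσ.nontrivial
  -- Scale a nonzero element of minimal support so that one coordinate becomes `1`; then its image
  -- under `σ` minus itself has smaller support, hence vanishes.
  obtain ⟨l, ⟨hlN, hl0⟩, hmin⟩ := exists_minimalFor_of_wellFoundedLT
    (fun l : J →₀ R => l ∈ N ∧ l ≠ 0) Finsupp.support (Submodule.exists_mem_ne_zero_of_ne_bot hN0)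
  obtain ⟨j, hj⟩ := Finsupp.ne_iff.1 hl0
  obtain ⟨l', ⟨hl'N, hl'supp⟩, hl'j⟩ :=
    hσ.exists_mem_apply_eq_one (N := N ⊓ Finsupp.supported R R l.support)
      (fun l' hl' => ⟨hN l' hl'.1, (Finset.coe_subset.2 Finsupp.support_mapRange).trans hl'.2⟩)
      ⟨hlN, (Finsupp.mem_supported R l).2 subset_rfl⟩ hj
  set d := l'.mapRange σ (map_zero σ) - l' with hd
  have hdj : d j = 0 := by simp [hd, hl'j]
  have hdsupp : d.support ⊆ l.support := fun i hi => by
    refine hl'supp (Finsupp.mem_support_iff.2 fun h0 => Finsupp.mem_support_iff.1 hi ?_)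
    simp [hd, h0]
  have hd0 : d = 0 := by
    by_contra hne
    exact Finsupp.mem_support_iff.1
      (hmin ⟨N.sub_mem (hN l' hl'N) hl'N, hne⟩ hdsupp (Finsupp.mem_support_iff.2 hj)) hdj
  refine ⟨l', hl'N, fun h0 => ?_, fun i => ?_⟩
  · simp [h0] at hl'j
  · simpa [hd, sub_eq_zero] using DFunLike.congr_fun hd0 i

theorem linearIndependent_of_fixed (hσ : IsDifferenceSimple σ) (h : IsDifferenceAlgebra σ τ)
    {J : Type*} {e : J → S} (he : ∀ j, τ (e j) = e j)
    (hli : LinearIndependent (constantSubring σ) e) : LinearIndependent R e := by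
  rw [linearIndependent_iff_ker]
  by_contra hker
  obtain ⟨l, hl, hl0, hfix⟩ := hσ.exists_fixed_mem_of_ne_bot (fun l hl => by
    rw [LinearMap.mem_ker] at hl ⊢
    rw [h.linearCombination_mapRange he, hl, map_zero]) hker
  obtain ⟨j, hj⟩ := Finsupp.ne_iff.1 hl0
  have hj0 := linearIndependent_iff'.1 hli l.support (fun i => ⟨l i, hfix i⟩) hl j
    (Finsupp.mem_support_iff.2 hj)
  exact hj (congrArg Subtype.val hj0)

end IsDifferenceSimple

section CommutativeAlgebra

theorem ringKrullDim_eq_of_isIntegral_of_injective {R S : Type*} [CommRing R] [CommRing S]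
    [Algebra R S] [Algebra.IsIntegral R S] (hinj : Function.Injective (algebraMap R S)) :
    ringKrullDim S = ringKrullDim R := by
  apply le_antisymm
  · exact Order.krullDim_le_of_strictMono (PrimeSpectrum.comap (algebraMap R S))
      fun p q hpq => Ideal.IsIntegral.comap_lt_comap (A := S) hpq
  · refine iSup_le fun l => ?_
    obtain ⟨Q, -, _, hQ⟩ := Ideal.exists_ideal_over_prime_of_isIntegral (S := S)
      l.head.asIdeal ⊥ (by rw [Ideal.comap_bot_of_injective _ hinj]; exact bot_le)
    have : Q.LiesOver l.head.asIdeal := ⟨hQ.symm⟩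
    obtain ⟨L, hL, -, -⟩ := Ideal.exists_ltSeries_of_hasGoingUp l Q
    rw [← hL]
    exact le_iSup (fun L : LTSeries (PrimeSpectrum S) => ((L.length : ℕ∞) : WithBot ℕ∞)) L

theorem exists_ne_zero_forall_mem_range_comap {A B : Type*} [CommRing A] [IsDomain A]
    [IsNoetherianRing A] [CommRing B] {f : A →+* B} (hf : f.FiniteType)
    (hinj : Function.Injective f) :
    ∃ g : A, g ≠ 0 ∧
      ∀ p : PrimeSpectrum A, g ∉ p.asIdeal → p ∈ Set.range (PrimeSpectrum.comap f) := by
  obtain ⟨D, hD⟩ := PrimeSpectrum.exists_constructibleSetData_iff.2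
    (PrimeSpectrum.isConstructible_range_comap (RingHom.FinitePresentation.of_finiteType.1 hf))
  have hbot : (⊥ : PrimeSpectrum A) ∈ D.toSet := by
    rw [hD]
    obtain ⟨q, hq, hq'⟩ := Ideal.exists_comap_eq_of_mem_minimalPrimes_of_injective hinj ⊥
      (by simp only [IsDomain.minimalPrimes_eq_singleton_bot, Set.mem_singleton_iff])
    exact ⟨⟨q, hq⟩, PrimeSpectrum.ext hq'⟩
  rw [PrimeSpectrum.ConstructibleSetData.toSet, Set.mem_iUnion₂] at hbot
  -- The locally closed piece `V(g₁, …, gₙ) \ V(f)` that contains the generic point has `gᵢ = 0`.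
  obtain ⟨C, hCD, hgC, hfC⟩ := hbot
  refine ⟨C.f, fun h0 => hfC (by simp [h0]), fun p hp => ?_⟩
  rw [← hD, PrimeSpectrum.ConstructibleSetData.toSet, Set.mem_iUnion₂]
  refine ⟨C, hCD, ?_, fun h => hp (h rfl)⟩
  rintro _ ⟨i, rfl⟩
  have hgi : C.g i = 0 := by simpa using hgC (Set.mem_range_self i)
  simp [hgi]

theorem isAlgebraic_of_forall_mem_adjoin_isUnit (k : Type*) {K S : Type*} [Field k] [Field K]
    [CommRing S] [Algebra k K] [Algebra K S] [Algebra k S] [IsScalarTower k K S]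
    [Algebra.FiniteType K S] {c : S}
    (hc : ∀ b ∈ Algebra.adjoin k {c}, b ≠ 0 → IsUnit b) : IsAlgebraic K c := by
  by_contra htr
  let f : Polynomial K →ₐ[K] S := Polynomial.aeval c
  have hinj : Function.Injective f := transcendental_iff_injective.1 htr
  have hft : (f : Polynomial K →+* S).FiniteType := by
    refine RingHom.FiniteType.of_comp_finiteType (f := algebraMap K (Polynomial K)) ?_
    rw [AlgHom.comp_algebraMap]
    exact RingHom.finiteType_algebraMap.2 inferInstance
  obtain ⟨g, hg0, hg⟩ := exists_ne_zero_forall_mem_range_comap hft hinj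
  -- A prime of `S` over the kernel of the evaluation at a suitable `α` algebraic over `k` contains
  -- `p(c)`, where `p` is the minimal polynomial of `α` over `k`.
  let φ : AlgebraicClosure k →ₐ[k] AlgebraicClosure K := IsAlgClosed.lift
  obtain ⟨_, ⟨α, rfl⟩, hα⟩ := (Set.infinite_range_of_injective φ.injective).exists_notMem_finite
    (Polynomial.rootSet_finite g (AlgebraicClosure K))
  let ev : Polynomial K →ₐ[K] AlgebraicClosure K := Polynomial.aeval (φ α)
  obtain ⟨q, hq⟩ := hg ⟨RingHom.ker ev, RingHom.ker_isPrime _⟩ fun h =>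
    hα ((Polynomial.mem_rootSet_of_ne hg0).2 h)
  have hα_int : IsIntegral k α := Algebra.IsIntegral.isIntegral α
  set p := minpoly k α
  have hpq : Polynomial.aeval c p ∈ q.asIdeal := by
    have hker : p.map (algebraMap k K) ∈ RingHom.ker ev := by
      rw [RingHom.mem_ker, Polynomial.aeval_map_algebraMap, Polynomial.aeval_algHom_apply,
        minpoly.aeval, map_zero]
    rw [← Polynomial.aeval_map_algebraMap K]
    exact (congrArg PrimeSpectrum.asIdeal hq).ge hker
  refine q.isPrime.ne_top (Ideal.eq_top_of_isUnit_mem _ hpq (hc _ ?_ fun h0 => ?_))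
  · exact Polynomial.aeval_mem_adjoin_singleton k c
  · rw [← Polynomial.aeval_map_algebraMap K] at h0
    exact Polynomial.map_ne_zero (minpoly.ne_zero hα_int)
      (hinj (h0.trans (map_zero f).symm))

end CommutativeAlgebra

section PrimeDecomposition

open scoped Pointwise

variable {R : Type*} [CommRing R] {σ : R ≃+* R} {P : Ideal R}

theorem smul_ideal_eq_map (σ : R ≃+* R) (I : Ideal R) : σ • I = I.map (σ : R →+* R) := rfl

theorem smul_ideal_le_iff {I : Ideal R} : σ • I ≤ I ↔ ∀ a ∈ I, σ a ∈ I :=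
  Ideal.map_le_iff_le_comap

theorem IsDifferenceSimple.iInf_pow_smul_eq_bot (hσ : IsDifferenceSimple σ) {ℓ : ℕ} (hℓ : 0 < ℓ)
    {J : Ideal R} (hJ : σ ^ ℓ • J ≤ J) (hJ_top : J ≠ ⊤) : ⨅ i : Fin ℓ, σ ^ (i : ℕ) • J = ⊥ := by
  refine (hσ.eq_bot_or_eq_top _ (smul_ideal_le_iff.1 (le_iInf ?_))).resolve_right fun htop => ?_
  · have hstep : ∀ i : Fin ℓ, σ • ⨅ i : Fin ℓ, σ ^ (i : ℕ) • J ≤ σ ^ (i + 1 : ℕ) • J := fun i => by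
      rw [pow_succ', mul_smul]
      exact smul_mono_right σ (iInf_le _ i)
    rintro ⟨_ | i, hi⟩
    · rw [pow_zero, one_smul]
      have hlast := hstep ⟨ℓ - 1, Nat.sub_lt hℓ one_pos⟩
      rw [Fin.val_mk, Nat.sub_one_add_one hℓ.ne'] at hlast
      exact hlast.trans hJ
    · exact hstep ⟨i, Nat.lt_of_succ_lt hi⟩
  · refine hJ_top (eq_top_iff.2 (htop.ge.trans ((iInf_le _ ⟨0, hℓ⟩).trans_eq ?_)))
    rw [pow_zero, one_smul]

theorem IsDifferenceSimple.pow [IsDomain R] (hσ : IsDifferenceSimple σ) {m : ℕ} (hm : m ≠ 0) :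
    IsDifferenceSimple (σ ^ m) := by
  refine ⟨hσ.nontrivial, fun I hI => ?_⟩
  by_contra! hI'
  obtain ⟨d, hd, hd0⟩ := Submodule.exists_mem_ne_zero_of_ne_bot hI'.1
  have hmem : ∏ i : Fin m, (σ ^ (i : ℕ)) d ∈ ⨅ i : Fin m, σ ^ (i : ℕ) • I :=
    Ideal.mem_iInf.2 fun i => Ideal.mem_of_dvd _ (Finset.dvd_prod_of_mem _ (Finset.mem_univ i))
      (Ideal.smul_mem_pointwise_smul _ _ _ hd)
  rw [hσ.iInf_pow_smul_eq_bot (Nat.pos_of_ne_zero hm) (smul_ideal_le_iff.2 hI) hI'.2,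
    Ideal.mem_bot, Finset.prod_eq_zero_iff] at hmem
  obtain ⟨i, -, hi⟩ := hmem
  exact hd0 ((map_eq_zero_iff _ (σ ^ (i : ℕ)).injective).1 hi)

theorem smul_mem_minimalPrimes (σ : R ≃+* R) (hP : P ∈ minimalPrimes R) :
    σ • P ∈ minimalPrimes R := by
  have := hP.1.1
  refine ⟨⟨inferInstance, bot_le⟩, fun J hJ hJP => ?_⟩
  have := hJ.1
  rw [Ideal.pointwise_smul_subset_iff]
  rw [Ideal.subset_pointwise_smul_iff] at hJP
  exact hP.2 ⟨inferInstance, bot_le⟩ hJP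

theorem eq_of_smul_le_of_mem_minimalPrimes (hP : P ∈ minimalPrimes R) (h : σ • P ≤ P) :
    σ • P = P :=
  h.antisymm (hP.2 (smul_mem_minimalPrimes σ hP).1 h)

theorem period_pos_of_mem_minimalPrimes [IsNoetherianRing R] (σ : R ≃+* R)
    (hP : P ∈ minimalPrimes R) : 0 < MulAction.period σ P := by
  obtain ⟨i, j, hij, heq : σ ^ i • P = σ ^ j • P⟩ :=
    (minimalPrimes.finite_of_isNoetherianRing R).exists_lt_map_eq_of_forall_mem
      fun i : ℕ => smul_mem_minimalPrimes (σ ^ i) hP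
  refine MulAction.period_pos_of_fixed (Nat.sub_pos_of_lt hij) ?_
  rw [← smul_left_cancel_iff (σ ^ i), smul_smul, ← pow_add, Nat.add_sub_cancel' hij.le, heq]

namespace IsDifferenceSimple

theorem eq_or_eq_top_of_le [IsNoetherianRing R] (hσ : IsDifferenceSimple σ)
    (hP : P ∈ minimalPrimes R) {J : Ideal R} (hJ : σ ^ MulAction.period σ P • J ≤ J) (hPJ : P ≤ J) :
    J = P ∨ J = ⊤ := by
  rw [or_iff_not_imp_right]
  intro hJ_top
  have hle : ⨅ i : Fin (MulAction.period σ P), σ ^ (i : ℕ) • J ≤ P := by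
    rw [hσ.iInf_pow_smul_eq_bot (period_pos_of_mem_minimalPrimes σ hP) hJ hJ_top]
    exact bot_le
  rw [← Finset.inf_univ_eq_iInf, hP.1.1.inf_le'] at hle
  obtain ⟨i, -, hi⟩ := hle
  have hfix : σ ^ (i : ℕ) • P = P :=
    eq_of_smul_le_of_mem_minimalPrimes hP ((smul_mono_right _ hPJ).trans hi)
  rw [Nat.eq_zero_of_dvd_of_lt (MulAction.pow_smul_eq_iff_period_dvd.1 hfix) i.2, pow_zero,
    one_smul] at hi
  exact hi.antisymm hPJ

theorem isCoprime_pow_smul [IsNoetherianRing R] (hσ : IsDifferenceSimple σ)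
    (hP : P ∈ minimalPrimes R) {i j : ℕ} (hij : i < j) (hj : j < MulAction.period σ P) :
    IsCoprime (σ ^ i • P) (σ ^ j • P) := by
  have hstable : σ ^ MulAction.period σ P • (P ⊔ σ ^ (j - i) • P) ≤ P ⊔ σ ^ (j - i) • P := by
    rw [Ideal.smul_sup, smul_smul, (Commute.pow_pow_self σ _ _).eq, mul_smul,
      MulAction.pow_period_smul]
  have htop : P ⊔ σ ^ (j - i) • P = ⊤ := by
    refine (hσ.eq_or_eq_top_of_le hP hstable le_sup_left).resolve_left fun h => ?_
    have hfix := eq_of_smul_le_of_mem_minimalPrimes hP (le_sup_right.trans_eq h)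
    have := Nat.le_of_dvd (Nat.sub_pos_of_lt hij) (MulAction.pow_smul_eq_iff_period_dvd.1 hfix)
    omega
  have := congrArg (σ ^ i • ·) htop
  simp only [Ideal.smul_sup, smul_smul, ← pow_add, Nat.add_sub_cancel' hij.le] at this
  rw [Ideal.isCoprime_iff_sup_eq, this, smul_ideal_eq_map, Ideal.map_top]

theorem isPrimeDecomposition_period [IsNoetherianRing R] (hσ : IsDifferenceSimple σ)
    (hP : P ∈ minimalPrimes R) : IsPrimeDecomposition σ (MulAction.period σ P) P where
  pos := period_pos_of_mem_minimalPrimes σ hP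
  isPrime := hP.1.1
  stable := (MulAction.pow_period_smul σ P).symm
  maximal _ hJ hPJ := hσ.eq_or_eq_top_of_le hP (smul_ideal_le_iff.2 hJ) hPJ
  bijective := by
    constructor
    · rw [injective_iff_map_eq_zero]
      intro a ha
      rw [← Ideal.mem_bot, ← hσ.iInf_pow_smul_eq_bot (period_pos_of_mem_minimalPrimes σ hP)
        (MulAction.pow_period_smul σ P).le hP.1.1.ne_top, Ideal.mem_iInf]
      exact fun i => Ideal.Quotient.eq_zero_iff_mem.1 (congrFun ha i)
    · refine Ideal.pi_mkQ_surjective (I := fun i : Fin _ => σ ^ (i : ℕ) • P) fun i j hij => ?_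
      rcases lt_or_gt_of_ne hij with h | h
      · exact hσ.isCoprime_pow_smul hP h j.2
      · exact (hσ.isCoprime_pow_smul hP h i.2).symm

theorem exists_isPrimeDecomposition [IsNoetherianRing R] (hσ : IsDifferenceSimple σ) :
    ∃ (ℓ : ℕ) (P : Ideal R), IsPrimeDecomposition σ ℓ P :=
  have := hσ.nontrivial
  let ⟨P, hP⟩ := Ideal.nonempty_minimalPrimes (I := (⊥ : Ideal R)) bot_ne_top
  ⟨_, P, hσ.isPrimeDecomposition_period hP⟩

end IsDifferenceSimple

end PrimeDecomposition

section Finiteness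

variable {K S : Type*} [Field K] [CommRing S] [Algebra K S] {σ : K ≃+* K} {τ : S ≃+* S}

theorem IsDifferenceSimple.isAlgebraic_of_fixed [Algebra.FiniteType K S]
    (hτ : IsDifferenceSimple τ) (h : IsDifferenceAlgebra σ τ) {c : S} (hc : τ c = c) :
    IsAlgebraic K c := by
  refine isAlgebraic_of_forall_mem_adjoin_isUnit (constantField σ) fun b hb =>
    hτ.isUnit_of_fixed ?_
  induction hb using Algebra.adjoin_induction with
  | mem x hx => rwa [Set.mem_singleton_iff.1 hx]
  | algebraMap a => exact h.algebraMap_mem_constantSubring a.2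
  | add x y _ _ hx hy => rw [map_add, hx, hy]
  | mul x y _ _ hx hy => rw [map_mul, hx, hy]

theorem IsDifferenceSimple.isAlgebraic_of_periodic [IsDomain S] [Algebra.FiniteType K S]
    (hτ : IsDifferenceSimple τ) (h : IsDifferenceAlgebra σ τ) {c : S}
    (hc : c ∈ periodicSubmodule τ) : IsAlgebraic K c :=
  let ⟨_, hm, hmc⟩ := hc
  (hτ.pow hm).isAlgebraic_of_fixed (h.pow _) hmc

theorem finite_integralClosure_of_finiteType (K S : Type*) [Field K] [CommRing S] [IsDomain S]
    [Algebra K S] [Algebra.FiniteType K S] : Module.Finite K (integralClosure K S) := by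
  let _ : Field (integralClosure K S) :=
    (isField_of_isIntegral_of_isField' (Field.toIsField K)).toField
  exact finite_of_algHom_finiteType_of_isJacobsonRing (integralClosure K S).val

theorem IsDifferenceAlgebra.linearIndependent_of_periodic [Nontrivial S]
    (h : IsDifferenceAlgebra σ τ)
    (hσ : periodicField σ ≤ constantField σ) {ι : Type*} [Finite ι] {d : ι → S}
    (hd : ∀ i, d i ∈ periodicSubmodule τ) (hli : LinearIndependent (constantSubring τ) d) :
    LinearIndependent K d := by
  obtain ⟨N, hN, hdN⟩ := exists_common_period hd
  refine (IsDifferenceSimple.of_field (σ ^ N)).linearIndependent_of_fixed (h.pow N) hdN ?_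
  have hmem : ∀ c : constantSubring (σ ^ N), algebraMap K S c ∈ constantSubring τ := fun c =>
    h.algebraMap_mem_constantSubring (hσ ⟨N, hN, c.2⟩)
  rw [linearIndependent_iff'] at hli ⊢
  intro s g hg i hi
  have hsum : ∑ j ∈ s, (⟨_, hmem (g j)⟩ : constantSubring τ) • d j = 0 := by
    rw [← hg]
    exact Finset.sum_congr rfl fun j _ => (Algebra.smul_def (g j : K) (d j)).symm
  have hgi : algebraMap K S (g i) = 0 := congrArg Subtype.val (hli s _ hsum i hi)
  exact Subtype.ext ((map_eq_zero_iff _ (FaithfulSMul.algebraMap_injective K S)).1 hgi)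

theorem IsDifferenceSimple.rank_periodicSubmodule_le [IsDomain S] [Algebra.FiniteType K S]
    (hτ : IsDifferenceSimple τ) (h : IsDifferenceAlgebra σ τ)
    (hσ : periodicField σ ≤ constantField σ) :
    Module.rank (constantSubring τ) (periodicSubmodule τ) ≤
      (Module.finrank K (integralClosure K S) : ℕ) := by
  have := finite_integralClosure_of_finiteType K S
  have := hτ.nontrivial
  refine rank_le fun s hs => ?_
  have hli : LinearIndependent K fun i : s => ((i : periodicSubmodule τ) : S) :=
    h.linearIndependent_of_periodic hσ (fun i => i.1.2)
      (hs.map' (periodicSubmodule τ).subtype (Submodule.ker_subtype _))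
  let v : s → integralClosure K S := fun i => ⟨i.1, (hτ.isAlgebraic_of_periodic h i.1.2).isIntegral⟩
  have hv : LinearIndependent K v :=
    LinearIndependent.of_comp (integralClosure K S).val.toLinearMap hli
  simpa only [Fintype.card_coe] using hv.fintype_card_le_finrank

end Finiteness

section FractionField

variable {S F : Type*} [CommRing S] [Field F] [Algebra S F] {τ : S ≃+* S} {τF : F ≃+* F}

theorem constantField_le_periodicField (σ : F ≃+* F) : constantField σ ≤ periodicField σ :=
  fun a (ha : σ a = a) => ⟨1, one_ne_zero, by rwa [pow_one]⟩

theorem IsDifferenceSimple.exists_algebraMap_eq_of_periodic [IsDomain S] [IsFractionRing S F]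
    (hτ : IsDifferenceSimple τ) (h : IsDifferenceAlgebra τ τF) {x : F} (hx : x ∈ periodicField τF) :
    ∃ s, algebraMap S F s = x := by
  obtain ⟨m, hm, hmx⟩ := hx
  -- The denominators of `x` form a nonzero ideal of `S`, which is stable under `τ ^ m`.
  let I : Ideal S := (Algebra.linearMap S F).range.comap (LinearMap.toSpanSingleton S F x)
  have hI : ∀ r ∈ I, (τ ^ m) r ∈ I := by
    rintro r ⟨s, hs : algebraMap S F s = r • x⟩
    refine ⟨(τ ^ m) s, ?_⟩
    rw [Algebra.linearMap_apply, LinearMap.toSpanSingleton_apply, ← h.pow m, hs, Algebra.smul_def,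
      Algebra.smul_def, map_mul, hmx, h.pow m]
  obtain ⟨a, d, hd, rfl⟩ := IsFractionRing.div_surjective (A := S) x
  have hdI : d ∈ I := ⟨a, by
    rw [Algebra.linearMap_apply, LinearMap.toSpanSingleton_apply, Algebra.smul_def,
      mul_div_cancel₀ _ (IsFractionRing.to_map_ne_zero_of_mem_nonZeroDivisors hd)]⟩
  have htop : I = ⊤ := (hτ.pow hm).eq_top hI hdI (nonZeroDivisors.ne_zero hd)
  obtain ⟨s, hs : algebraMap S F s = (1 : S) • _⟩ := (I.eq_top_iff_one).1 htop
  exact ⟨s, hs.trans (one_smul S _)⟩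

end FractionField

theorem IsDifferenceSimple.relrank_constantField_periodicField.{u} {S F : Type u} [CommRing S]
    [IsDomain S] [Field F] [Algebra S F] [IsFractionRing S F] {τ : S ≃+* S} {τF : F ≃+* F}
    (hτ : IsDifferenceSimple τ) (h : IsDifferenceAlgebra τ τF) :
    Subfield.relrank (constantField τF) (periodicField τF) =
      Module.rank (constantSubring τ) (periodicSubmodule τ) := by
  have hle := constantField_le_periodicField τF
  have hinj : Function.Injective (algebraMap S F) := IsFractionRing.injective S F
  let i : constantSubring τ → constantField τF := fun c =>
    ⟨_, h.algebraMap_mem_constantSubring c.2⟩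
  let j : periodicSubmodule τ →+ Subfield.extendScalars hle :=
    { toFun := fun d => ⟨_, h.algebraMap_mem_periodicSubmodule d.2⟩
      map_zero' := Subtype.ext (map_zero _)
      map_add' := fun a b => Subtype.ext (map_add _ _ _) }
  have hi : Function.Bijective i := by
    refine ⟨fun a b hab => Subtype.ext (hinj (congrArg Subtype.val hab)), ?_⟩
    rintro ⟨x, hx⟩
    obtain ⟨s, rfl⟩ := hτ.exists_algebraMap_eq_of_periodic h (hle hx)
    exact ⟨⟨s, hinj ((h s).symm.trans hx)⟩, rfl⟩
  have hj : Function.Bijective j := by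
    refine ⟨fun a b hab => Subtype.ext (hinj (congrArg Subtype.val hab)), ?_⟩
    rintro ⟨x, hx⟩
    obtain ⟨s, rfl⟩ := hτ.exists_algebraMap_eq_of_periodic h hx
    obtain ⟨m, hm, hmx⟩ := hx
    exact ⟨⟨s, m, hm, hinj ((h.pow m s).symm.trans hmx)⟩, rfl⟩
  rw [Subfield.relrank_eq_rank_of_le hle]
  exact (rank_eq_of_equiv_equiv i (AddEquiv.ofBijective j hj) hi fun c d =>
    Subtype.ext (map_mul (algebraMap S F) (c : S) (d : S))).symm

theorem IsDifferenceSimple.periodicDegree_eq_rank {K S : Type*} [Field K] [CommRing S] [IsDomain S]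
    [Algebra K S] {σ : K ≃+* K} {τ : S ≃+* S} (hτ : IsDifferenceSimple τ)
    (hK : ∀ a ∈ periodicField σ, algebraMap K S a ∈ constantSubring τ) :
    periodicDegree σ (FractionRing S) (IsFractionRing.ringEquivOfRingEquiv τ) =
      Module.rank (constantSubring τ) (periodicSubmodule τ) := by
  have h : IsDifferenceAlgebra τ
      (IsFractionRing.ringEquivOfRingEquiv τ : FractionRing S ≃+* FractionRing S) :=
    IsFractionRing.ringEquivOfRingEquiv_algebraMap τ
  rw [periodicDegree, sup_eq_right.2, hτ.relrank_constantField_periodicField h]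
  rintro _ ⟨a, ha, rfl⟩
  rw [IsScalarTower.algebraMap_apply K S (FractionRing S)]
  exact h.algebraMap_mem_constantSubring (hK a ha)

theorem IsDifferenceSimple.free {R : Type*} [CommRing R] {σ : R ≃+* R} (hσ : IsDifferenceSimple σ)
    (M : Type*) [AddCommGroup M] [Module (constantSubring σ) M] :
    Module.Free (constantSubring σ) M :=
  let _ := hσ.isField_constantSubring.toField
  Module.Free.of_divisionRing (constantSubring σ) M

theorem isDifferenceSimple_quotientEquiv {R : Type*} [CommRing R] {σ : R ≃+* R} {P : Ideal R}
    (hP : P ≠ ⊤) (h : P = P.map (σ : R →+* R))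
    (hmax : ∀ J : Ideal R, (∀ a ∈ J, σ a ∈ J) → P ≤ J → J = P ∨ J = ⊤) :
    IsDifferenceSimple (Ideal.quotientEquiv P P σ h) := by
  refine ⟨Ideal.Quotient.nontrivial_iff.2 hP, fun J hJ => ?_⟩
  have hinj := Ideal.comap_injective_of_surjective (Ideal.Quotient.mk P)
    Ideal.Quotient.mk_surjective
  have hbot : P = Ideal.comap (Ideal.Quotient.mk P) ⊥ := P.mk_ker.symm
  refine (hmax (J.comap (Ideal.Quotient.mk P)) (fun a => hJ _) ?_).imp
    (fun hJP => hinj (hJP.trans hbot)) fun hJtop => hinj hJtop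
  exact hbot.le.trans (Ideal.comap_mono bot_le)

namespace IsPrimeDecomposition

variable {R : Type*} [CommRing R] {σ : R ≃+* R} {ℓ : ℕ} {P : Ideal R}

/-- The automorphism of the component `R/P` of `R` that is induced by `σ^ℓ`. -/
noncomputable def quotientAut (h : IsPrimeDecomposition σ ℓ P) : R ⧸ P ≃+* R ⧸ P :=
  Ideal.quotientEquiv P P (σ ^ ℓ) h.stable

theorem isDifferenceAlgebra_quotientAut (h : IsPrimeDecomposition σ ℓ P) :
    IsDifferenceAlgebra (σ ^ ℓ) h.quotientAut := fun _ => rfl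

theorem isDifferenceSimple_quotientAut (h : IsPrimeDecomposition σ ℓ P) :
    IsDifferenceSimple h.quotientAut :=
  isDifferenceSimple_quotientEquiv h.isPrime.ne_top h.stable h.maximal

/-- The decomposition of `R` as a power of `R/P`, where the component `R/σ^i(P)` is identified with
`R/P` by means of `σ^i`. -/
noncomputable def componentEquiv (h : IsPrimeDecomposition σ ℓ P) : R ≃+* (Fin ℓ → R ⧸ P) :=
  (RingEquiv.ofBijective _ h.bijective).trans <|
    RingEquiv.piCongrRight fun i => (Ideal.quotientEquiv P _ (σ ^ (i : ℕ)) rfl).symm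

theorem componentEquiv_apply (h : IsPrimeDecomposition σ ℓ P) (r : R) (i : Fin ℓ) :
    h.componentEquiv r i = Ideal.Quotient.mk P ((σ ^ (i : ℕ)).symm r) := rfl

theorem componentEquiv_pow (h : IsPrimeDecomposition σ ℓ P) (m : ℕ) (r : R) (i : Fin ℓ) :
    h.componentEquiv ((σ ^ (ℓ * m)) r) i = (h.quotientAut ^ m) (h.componentEquiv r i) := by
  have hquot := h.isDifferenceAlgebra_quotientAut.pow m
  rw [componentEquiv_apply, componentEquiv_apply, ← Ideal.Quotient.algebraMap_eq, hquot, ← pow_mul]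
  congr 1
  rw [RingEquiv.symm_apply_eq, ← RingAut.mul_apply, ← pow_add, add_comm, pow_add,
    RingAut.mul_apply, RingEquiv.apply_symm_apply]

theorem componentEquiv_apply_succ (h : IsPrimeDecomposition σ ℓ P) (r : R) {i : ℕ}
    (hi : i + 1 < ℓ) :
    h.componentEquiv (σ r) ⟨i + 1, hi⟩ = h.componentEquiv r ⟨i, Nat.lt_of_succ_lt hi⟩ := by
  rw [componentEquiv_apply, componentEquiv_apply]
  congr 1
  rw [RingEquiv.symm_apply_eq, pow_succ', RingAut.mul_apply, RingEquiv.apply_symm_apply]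

theorem componentEquiv_apply_zero (h : IsPrimeDecomposition σ ℓ P) (r : R) :
    h.componentEquiv (σ r) ⟨0, h.pos⟩ =
      h.quotientAut (h.componentEquiv r ⟨ℓ - 1, Nat.sub_lt h.pos one_pos⟩) := by
  rw [componentEquiv_apply, componentEquiv_apply, ← Ideal.Quotient.algebraMap_eq,
    h.isDifferenceAlgebra_quotientAut]
  congr 1
  obtain ⟨k, rfl⟩ := Nat.exists_eq_add_one.2 h.pos
  rw [pow_succ', RingAut.mul_apply]
  exact congrArg σ ((σ ^ k).apply_symm_apply r).symm

theorem componentEquiv_apply_of_mem_constantSubring (h : IsPrimeDecomposition σ ℓ P) {r : R}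
    (hr : r ∈ constantSubring σ) (i : Fin ℓ) : h.componentEquiv r i = Ideal.Quotient.mk P r := by
  rw [componentEquiv_apply, (RingEquiv.symm_apply_eq _).2 (pow_apply_of_fixed hr i).symm]

theorem mem_constantSubring_of_componentEquiv (h : IsPrimeDecomposition σ ℓ P) {r : R} {c : R ⧸ P}
    (hc : c ∈ constantSubring h.quotientAut) (hr : h.componentEquiv r = fun _ => c) :
    r ∈ constantSubring σ := by
  refine h.componentEquiv.injective (funext ?_)
  change ∀ i, h.componentEquiv (σ r) i = h.componentEquiv r i
  rintro ⟨_ | i, hi⟩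
  · rw [componentEquiv_apply_zero, hr]
    exact hc
  · rw [componentEquiv_apply_succ, hr]

theorem mem_periodicSubmodule_iff (h : IsPrimeDecomposition σ ℓ P) {r : R} :
    r ∈ periodicSubmodule σ ↔ ∀ i, h.componentEquiv r i ∈ periodicSubmodule h.quotientAut := by
  constructor
  · rintro ⟨m, hm, hmr⟩ i
    exact ⟨m, hm, by rw [← componentEquiv_pow, pow_apply_of_dvd hmr (dvd_mul_left m ℓ)]⟩
  · intro hr
    obtain ⟨m, hm, hmr⟩ := exists_common_period hr
    refine ⟨ℓ * m, mul_ne_zero h.pos.ne' hm, h.componentEquiv.injective (funext fun i => ?_)⟩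
    rw [componentEquiv_pow, hmr]

theorem bijective_constantSubring_quotient (h : IsPrimeDecomposition σ ℓ P) :
    Function.Bijective fun c : constantSubring σ => (⟨Ideal.Quotient.mk P c,
      h.isDifferenceAlgebra_quotientAut.algebraMap_mem_constantSubring
        (pow_apply_of_fixed c.2 ℓ)⟩ : constantSubring h.quotientAut) := by
  constructor
  · intro a b hab
    refine Subtype.ext (h.componentEquiv.injective (funext fun i => ?_))
    rw [h.componentEquiv_apply_of_mem_constantSubring a.2,
      h.componentEquiv_apply_of_mem_constantSubring b.2]
    exact congrArg Subtype.val hab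
  · rintro ⟨c, hc⟩
    obtain ⟨r, hr⟩ := h.componentEquiv.surjective fun _ => c
    exact ⟨⟨r, h.mem_constantSubring_of_componentEquiv hc hr⟩,
      Subtype.ext (congrFun hr ⟨0, h.pos⟩)⟩

/-- The decomposition of the periodic elements induced by that of `R`. -/
noncomputable def periodicEquiv (h : IsPrimeDecomposition σ ℓ P) :
    periodicSubmodule σ ≃+ (Fin ℓ → periodicSubmodule h.quotientAut) where
  toFun d i := ⟨h.componentEquiv d i, h.mem_periodicSubmodule_iff.1 d.2 i⟩
  invFun d := ⟨h.componentEquiv.symm fun i => d i, h.mem_periodicSubmodule_iff.2 fun i => by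
    rw [RingEquiv.apply_symm_apply]; exact (d i).2⟩
  left_inv d := Subtype.ext (h.componentEquiv.symm_apply_apply d)
  right_inv d := funext fun i => Subtype.ext (congrFun (h.componentEquiv.apply_symm_apply _) i)
  map_add' a b := funext fun i => Subtype.ext (congrFun (map_add h.componentEquiv (a : R) b) i)

theorem rank_periodicSubmodule (h : IsPrimeDecomposition σ ℓ P) :
    Module.rank (constantSubring σ) (periodicSubmodule σ) =
      ℓ * Module.rank (constantSubring h.quotientAut) (periodicSubmodule h.quotientAut) := by
  have := h.isDifferenceSimple_quotientAut.nontrivial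
  have := h.isDifferenceSimple_quotientAut.free (periodicSubmodule h.quotientAut)
  rw [rank_eq_of_equiv_equiv _ h.periodicEquiv h.bijective_constantSubring_quotient,
    rank_fun_eq_lift_mul, Fintype.card_fin, Cardinal.lift_uzero]
  intro c d
  refine funext fun i => Subtype.ext ?_
  change h.componentEquiv (c * d) i = Ideal.Quotient.mk P c * h.componentEquiv d i
  rw [map_mul, Pi.mul_apply, h.componentEquiv_apply_of_mem_constantSubring c.2]

end IsPrimeDecomposition

section MInvariant

variable {K R : Type*} [Field K] [CommRing R] [Algebra K R] {σK : K ≃+* K} {σ : R ≃+* R}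

theorem periodicField_pow_le_constantField (hK : periodicField σK ≤ constantField σK) {ℓ : ℕ}
    (hℓ : ℓ ≠ 0) : periodicField (σK ^ ℓ) ≤ constantField (σK ^ ℓ) := by
  rintro a ⟨m, hm, ha⟩
  rw [← pow_mul] at ha
  exact pow_apply_of_fixed (hK ⟨_, mul_ne_zero hℓ hm, ha⟩) ℓ

theorem IsPrimeDecomposition.isDifferenceAlgebra {ℓ : ℕ} {P : Ideal R}
    (d : IsPrimeDecomposition σ ℓ P) (h : IsDifferenceAlgebra σK σ) :
    IsDifferenceAlgebra (σK ^ ℓ) d.quotientAut := fun a =>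
  (d.isDifferenceAlgebra_quotientAut (algebraMap K R a)).trans (congrArg _ (h.pow ℓ a))

theorem IsDifferenceSimple.finite_periodicSubmodule [Algebra.FiniteType K R]
    (hσ : IsDifferenceSimple σ) (h : IsDifferenceAlgebra σK σ)
    (hK : periodicField σK ≤ constantField σK) :
    Module.Finite (constantSubring σ) (periodicSubmodule σ) := by
  have := hσ.nontrivial
  have := hσ.free (periodicSubmodule σ)
  have := Algebra.FiniteType.isNoetherianRing K R
  obtain ⟨ℓ, P, d⟩ := hσ.exists_isPrimeDecomposition
  have := d.isPrime
  rw [← Module.rank_lt_aleph0_iff, d.rank_periodicSubmodule]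
  exact Cardinal.mul_lt_aleph0 Cardinal.natCast_lt_aleph0 <|
    (d.isDifferenceSimple_quotientAut.rank_periodicSubmodule_le (d.isDifferenceAlgebra h)
      (periodicField_pow_le_constantField hK d.pos.ne')).trans_lt Cardinal.natCast_lt_aleph0

theorem IsDifferenceSimple.hasMInvariant_finrank [Algebra.FiniteType K R]
    (hσ : IsDifferenceSimple σ) (h : IsDifferenceAlgebra σK σ)
    (hK : periodicField σK ≤ constantField σK) :
    HasMInvariant σK R σ (Module.finrank (constantSubring σ) (periodicSubmodule σ)) := by
  have := hσ.nontrivial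
  have := hσ.free (periodicSubmodule σ)
  have := hσ.finite_periodicSubmodule h hK
  have := Algebra.FiniteType.isNoetherianRing K R
  refine ⟨hσ.exists_isPrimeDecomposition, fun ℓ P d => ?_⟩
  have := d.isPrime
  rw [Module.finrank_eq_rank, d.rank_periodicSubmodule, inducedAut]
  congr 1
  exact d.isDifferenceSimple_quotientAut.periodicDegree_eq_rank fun a ha =>
    (d.isDifferenceAlgebra h).algebraMap_mem_constantSubring (pow_apply_of_fixed (hK ha) ℓ)

end MInvariant

section SpanFixed

variable {R S : Type*} [CommRing R] [CommRing S] [Algebra R S] {σ : R ≃+* R} {τ : S ≃+* S}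

theorem IsDifferenceSimple.exists_basis_of_span_fixed (hσ : IsDifferenceSimple σ)
    (h : IsDifferenceAlgebra σ τ) (hspan : Submodule.span R {s | τ s = s} = ⊤) :
    ∃ (ι : Set S) (E : Module.Basis ι R S), ∀ k, τ (E k) = E k := by
  let _ := hσ.isField_constantSubring.toField
  obtain ⟨B, hBfix, hBspan, hBli⟩ := exists_linearIndependent (constantSubring σ) {s | τ s = s}
  refine ⟨B, Module.Basis.mk (hσ.linearIndependent_of_fixed h (fun k => hBfix k.2) hBli) ?_,
    fun k => ?_⟩
  · rw [Subtype.range_coe, ← hspan, Submodule.span_le]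
    intro s hs
    exact Submodule.span_subset_span (constantSubring σ) R B (hBspan ▸ Submodule.subset_span hs)
  · rw [Module.Basis.mk_apply]
    exact hBfix k.2

namespace IsDifferenceAlgebra

variable {ι : Type*} {E : Module.Basis ι R S}

theorem basis_repr_apply (h : IsDifferenceAlgebra σ τ) (hE : ∀ k, τ (E k) = E k) (s : S) (k : ι) :
    E.repr (τ s) k = σ (E.repr s k) := by
  have := h.linearCombination_mapRange hE (E.repr s)
  rw [E.linearCombination_repr] at this
  rw [← this, E.repr_linearCombination, Finsupp.mapRange_apply]

theorem linearIndependent_algebraMap (h : IsDifferenceAlgebra σ τ) (hE : ∀ k, τ (E k) = E k)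
    {J : Type*} {d : J → R} (hd : LinearIndependent (constantSubring σ) d) :
    LinearIndependent (constantSubring τ) fun j => algebraMap R S (d j) := by
  rw [linearIndependent_iff'] at hd ⊢
  intro s c hc j hj
  have hfix : ∀ j k, E.repr (c j : S) k ∈ constantSubring σ := fun j k => by
    rw [mem_constantSubring, ← h.basis_repr_apply hE, mem_constantSubring.1 (c j).2]
  refine Subtype.ext (E.repr.map_eq_zero_iff.1 (Finsupp.ext fun k => ?_))
  refine congrArg Subtype.val (hd s (fun j => ⟨_, hfix j k⟩) ?_ j hj)
  have hk := DFunLike.congr_fun (congrArg E.repr hc) k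
  rw [map_sum, map_zero, Finsupp.finsetSum_apply, Finsupp.zero_apply] at hk
  rw [← hk]
  refine Finset.sum_congr rfl fun j _ => ?_
  rw [Subring.smul_def, Subring.smul_def, smul_eq_mul, smul_eq_mul, mul_comm, mul_comm (c j : S),
    ← Algebra.smul_def, map_smul, Finsupp.smul_apply, smul_eq_mul]

theorem algebraMap_mem_span (h : IsDifferenceAlgebra σ τ) {X : Set R} {r : R}
    (hr : r ∈ Submodule.span (constantSubring σ) X) :
    algebraMap R S r ∈ Submodule.span (constantSubring τ) (algebraMap R S '' X) := by
  induction hr using Submodule.span_induction with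
  | mem x hx => exact Submodule.subset_span ⟨x, hx, rfl⟩
  | zero => rw [map_zero]; exact Submodule.zero_mem _
  | add x y _ _ hx hy => rw [map_add]; exact Submodule.add_mem _ hx hy
  | smul c x _ hx =>
    rw [Subring.smul_def, smul_eq_mul, map_mul]
    exact Submodule.smul_mem _ (⟨_, h.algebraMap_mem_constantSubring c.2⟩ : constantSubring τ) hx

theorem periodicSubmodule_eq_span (h : IsDifferenceAlgebra σ τ) (hE : ∀ k, τ (E k) = E k)
    {X : Set R} (hX : Submodule.span (constantSubring σ) X = periodicSubmodule σ) :
    periodicSubmodule τ = Submodule.span (constantSubring τ) (algebraMap R S '' X) := by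
  refine le_antisymm ?_ (Submodule.span_le.2 ?_)
  · rintro s ⟨m, hm, hs⟩
    have hcoord : ∀ k, E.repr s k ∈ periodicSubmodule σ := fun k =>
      ⟨m, hm, by rw [← (h.pow m).basis_repr_apply (fun k => pow_apply_of_fixed (hE k) m), hs]⟩
    rw [← E.linearCombination_repr s, Finsupp.linearCombination_apply]
    refine Submodule.sum_mem _ fun k _ => ?_
    change E.repr s k • E k ∈ _
    rw [Algebra.smul_def, mul_comm]
    exact Submodule.smul_mem _ (⟨E k, hE k⟩ : constantSubring τ)
      (h.algebraMap_mem_span (hX ▸ hcoord k))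
  · rintro _ ⟨r, hr, rfl⟩
    exact h.algebraMap_mem_periodicSubmodule (hX ▸ Submodule.subset_span hr)

end IsDifferenceAlgebra

theorem IsDifferenceSimple.finrank_periodicSubmodule_eq [Nontrivial S]
    (hσ : IsDifferenceSimple σ) (h : IsDifferenceAlgebra σ τ)
    (hspan : Submodule.span R {s | τ s = s} = ⊤) :
    Module.finrank (constantSubring τ) (periodicSubmodule τ) =
      Module.finrank (constantSubring σ) (periodicSubmodule σ) := by
  obtain ⟨ι, E, hE⟩ := hσ.exists_basis_of_span_fixed h hspan
  have := hσ.nontrivial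
  have := hσ.free (periodicSubmodule σ)
  let b := Module.Free.chooseBasis (constantSubring σ) (periodicSubmodule σ)
  have hb : Submodule.span (constantSubring σ) (Set.range fun j => (b j : R)) =
      periodicSubmodule σ := by
    rw [Set.range_comp', ← Submodule.coe_subtype, ← Submodule.map_span]
    simp
  have hli := h.linearIndependent_algebraMap hE
    (b.linearIndependent.map' (periodicSubmodule σ).subtype (Submodule.ker_subtype _))
  have hτ := h.periodicSubmodule_eq_span hE hb
  rw [← Set.range_comp] at hτ
  rw [hτ]
  exact (Module.finrank_eq_nat_card_basis (Module.Basis.span hli)).trans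
    (Module.finrank_eq_nat_card_basis b).symm

end SpanFixed

theorem IsDifferenceSimple.ringKrullDim_eq {K R S : Type*} [Field K] [CommRing R] [CommRing S]
    [Algebra K R] [Algebra K S] [Algebra R S] [IsScalarTower K R S] [Algebra.FiniteType K S]
    {σK : K ≃+* K} {σ : R ≃+* R} {τ : S ≃+* S} (hτ : IsDifferenceSimple τ)
    (hσ : IsDifferenceSimple σ) (hK : IsDifferenceAlgebra σK τ) (h : IsDifferenceAlgebra σ τ)
    (hspan : Submodule.span R {s | τ s = s} = ⊤) : ringKrullDim S = ringKrullDim R := by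
  have := hτ.nontrivial
  have : Algebra.IsIntegral R S := by
    refine ⟨fun s => ?_⟩
    have hs : s ∈ Submodule.span R {s | τ s = s} := hspan ▸ Submodule.mem_top
    induction hs using Submodule.span_induction with
    | mem c hc => exact (hτ.isAlgebraic_of_fixed hK hc).isIntegral.tower_top
    | zero => exact isIntegral_zero
    | add x y _ _ hx hy => exact hx.add hy
    | smul r x _ hx => exact hx.smul r
  exact ringKrullDim_eq_of_isIntegral_of_injective (hσ.injective_algebraMap h)

section Compositum

variable {K : Type*} [CommRing K] {σ : K ≃+* K}

/-- The automorphism of a difference algebra as a semilinear map over that of the base ring. -/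
def IsDifferenceAlgebra.semilinearEquiv {R : Type*} [CommRing R] [Algebra K R] {τ : R ≃+* R}
    (h : IsDifferenceAlgebra σ τ) :
    letI := RingHomInvPair.of_ringEquiv σ
    letI := RingHomInvPair.of_ringEquiv_symm σ
    R ≃ₛₗ[(σ : K →+* K)] R :=
  letI := RingHomInvPair.of_ringEquiv σ
  letI := RingHomInvPair.of_ringEquiv_symm σ
  { τ with
    map_smul' := by
      intro a r
      change τ (a • r) = σ a • τ r
      rw [Algebra.smul_def, map_mul, h, Algebra.smul_def] }

variable {R₁ R₂ : Type*} [CommRing R₁] [CommRing R₂] [Algebra K R₁] [Algebra K R₂]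
  {σ₁ : R₁ ≃+* R₁} {σ₂ : R₂ ≃+* R₂}

open TensorProduct

/-- The automorphism `σ₁ ⊗ σ₂` of the tensor product of two difference algebras. -/
def tensorAut (h₁ : IsDifferenceAlgebra σ σ₁) (h₂ : IsDifferenceAlgebra σ σ₂) :
    R₁ ⊗[K] R₂ ≃+* R₁ ⊗[K] R₂ :=
  letI := RingHomInvPair.of_ringEquiv σ
  letI := RingHomInvPair.of_ringEquiv_symm σ
  { TensorProduct.congr h₁.semilinearEquiv h₂.semilinearEquiv with
    map_mul' := by
      intro x y
      change TensorProduct.congr _ _ _ = TensorProduct.congr _ _ _ * TensorProduct.congr _ _ _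
      induction x with
      | zero => simp only [zero_mul, map_zero]
      | add x x' hx hx' => simp only [add_mul, map_add, hx, hx']
      | tmul a b =>
        induction y with
        | zero => simp only [mul_zero, map_zero]
        | add y y' hy hy' => simp only [mul_add, map_add, hy, hy']
        | tmul c d =>
          simp only [TensorProduct.congr_tmul, Algebra.TensorProduct.tmul_mul_tmul]
          exact congrArg₂ (· ⊗ₜ[K] ·) (map_mul σ₁ a c) (map_mul σ₂ b d) }

theorem exists_isDifferenceSimple_quotient {T : Type*} [CommRing T] [IsNoetherianRing T]
    [Nontrivial T] (τ : T ≃+* T) :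
    ∃ (M : Ideal T) (h : M = M.map (τ : T →+* T)),
      IsDifferenceSimple (Ideal.quotientEquiv M M τ h) := by
  obtain ⟨M, ⟨hM, hMtop⟩, hmax⟩ := exists_maximal_of_wellFoundedGT
    (fun J : Ideal T => (∀ a ∈ J, τ a ∈ J) ∧ J ≠ ⊤) ⟨⊥, by simp, bot_ne_top⟩
  have hmax' (J : Ideal T) (hJ : ∀ a ∈ J, τ a ∈ J) (hMJ : M ≤ J) : J = M ∨ J = ⊤ :=
    or_iff_not_imp_right.2 fun hJtop => (hmax ⟨hJ, hJtop⟩ hMJ).antisymm hMJ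
  have hcomap : M.comap (τ : T →+* T) = M :=
    (hmax' _ (fun a => hM (τ a)) hM).resolve_right (Ideal.comap_ne_top _ hMtop)
  have hmap : M = M.map (τ : T →+* T) := by
    conv_rhs => rw [← hcomap]
    exact (Ideal.map_comap_of_surjective _ τ.surjective M).symm
  exact ⟨M, hmap, isDifferenceSimple_quotientEquiv hMtop hmap hmax'⟩

end Compositum

open TensorProduct in
attribute [local instance] Algebra.TensorProduct.rightAlgebra in
theorem exists_isDifferenceSimple_compositum.{v, w} {K : Type*} {R₁ : Type v} {R₂ : Type w}
    [Field K] [CommRing R₁] [CommRing R₂] [Algebra K R₁] [Algebra K R₂] [Nontrivial R₁]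
    [Nontrivial R₂] [Algebra.FiniteType K R₁] [Algebra.FiniteType K R₂]
    {σ : K ≃+* K} {σ₁ : R₁ ≃+* R₁} {σ₂ : R₂ ≃+* R₂}
    (h₁ : IsDifferenceAlgebra σ σ₁) (h₂ : IsDifferenceAlgebra σ σ₂) :
    ∃ (S : Type (max v w)) (_ : CommRing S) (_ : Algebra K S) (_ : Algebra R₁ S)
      (_ : Algebra R₂ S) (τ : S ≃+* S), IsScalarTower K R₁ S ∧ IsScalarTower K R₂ S ∧
      Algebra.FiniteType K S ∧ IsDifferenceSimple τ ∧ IsDifferenceAlgebra σ₁ τ ∧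
      IsDifferenceAlgebra σ₂ τ ∧ (algebraMap R₁ S).range ⊔ (algebraMap R₂ S).range = ⊤ := by
  have : Algebra.FiniteType K (R₁ ⊗[K] R₂) := .trans (S := R₁) inferInstance inferInstance
  have : IsNoetherianRing (R₁ ⊗[K] R₂) := Algebra.FiniteType.isNoetherianRing K _
  obtain ⟨M, hM, hsimple⟩ := exists_isDifferenceSimple_quotient (tensorAut h₁ h₂)
  refine ⟨(R₁ ⊗[K] R₂) ⧸ M, inferInstance, inferInstance, inferInstance, inferInstance, _,
    inferInstance, inferInstance, inferInstance, hsimple, fun r => ?_, fun r => ?_, ?_⟩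
  · exact congrArg (Ideal.Quotient.mk M) (congrArg (σ₁ r ⊗ₜ[K] ·) (map_one σ₂))
  · exact congrArg (Ideal.Quotient.mk M) (congrArg (· ⊗ₜ[K] σ₂ r) (map_one σ₁))
  · have hmk := Ideal.Quotient.mk_surjective (I := M)
    have hgen := congrArg (Subring.map (Ideal.Quotient.mk M))
      (Algebra.TensorProduct.closure_range_union_range_eq_top K R₁ R₂)
    rw [RingHom.map_closure, Set.image_union, Subring.closure_union, ← Set.range_comp,
      ← Set.range_comp, ← RingHom.range_eq_map, RingHom.range_eq_top.2 hmk] at hgen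
    exact (congrArg₂ (· ⊔ ·) (Subring.closure_eq _) (Subring.closure_eq _)).symm.trans hgen

theorem toSubmodule_adjoin_fixed {R S : Type*} [CommRing R] [CommRing S] [Algebra R S]
    (τ : S ≃+* S) : Subalgebra.toSubmodule (Algebra.adjoin R {s | τ s = s}) =
      Submodule.span R {s | τ s = s} := by
  have hclosure : Submonoid.closure {s | τ s = s} ≤ (constantSubring τ).toSubmonoid :=
    Submonoid.closure_le.2 fun _ hs => hs
  exact Algebra.adjoin_eq_span_of_subset R fun s hs => Submodule.subset_span (hclosure hs)

theorem IsDifferenceAlgebra.map_fundamental {K R S ι : Type*} [CommRing K] [CommRing R] [CommRing S]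
    [Algebra K R] [Algebra K S] [Algebra R S] [IsScalarTower K R S] [Fintype ι] [DecidableEq ι]
    {σ : R ≃+* R} {τ : S ≃+* S} (h : IsDifferenceAlgebra σ τ) {A : Matrix.GeneralLinearGroup ι K}
    {Z : Matrix.GeneralLinearGroup ι R}
    (hZ : (Z : Matrix ι ι R).map σ = (A : Matrix ι ι K).map (algebraMap K R) * (Z : Matrix ι ι R)) :
    Matrix.GeneralLinearGroup.map (τ : S →+* S)
        (Matrix.GeneralLinearGroup.map (algebraMap R S) Z) =
      Matrix.GeneralLinearGroup.map (algebraMap K S) A *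
        Matrix.GeneralLinearGroup.map (algebraMap R S) Z := by
  have hZ' : Matrix.GeneralLinearGroup.map (σ : R →+* R) Z =
      Matrix.GeneralLinearGroup.map (algebraMap K R) A * Z := Units.ext hZ
  have hcomp : (τ : S →+* S).comp (algebraMap R S) = (algebraMap R S).comp (σ : R →+* R) :=
    RingHom.ext h
  rw [IsScalarTower.algebraMap_eq K R S]
  calc
    _ = Matrix.GeneralLinearGroup.map ((τ : S →+* S).comp (algebraMap R S)) Z := rfl
    _ = Matrix.GeneralLinearGroup.map (algebraMap R S)
        (Matrix.GeneralLinearGroup.map (σ : R →+* R) Z) := by rw [hcomp]; rfl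
    _ = _ := by rw [hZ', map_mul]; rfl

theorem val_det_inv_map {R S ι : Type*} [CommRing R] [CommRing S] [Fintype ι] [DecidableEq ι]
    (f : R →+* S) (Z : Matrix.GeneralLinearGroup ι R) :
    ((Matrix.GeneralLinearGroup.map f Z)⁻¹.det : S) = f (Z⁻¹.det : R) := by
  rw [← map_inv, Matrix.GeneralLinearGroup.map_det, Units.coe_map, MonoidHom.coe_coe]

namespace IsPicardVessiotRing

variable {K : Type*} [Field K] {σK : K ≃+* K} {n : ℕ} {A : Matrix.GeneralLinearGroup (Fin n) K}

section

variable {R : Type*} [CommRing R] [Algebra K R] {σ : R ≃+* R}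

theorem isDifferenceSimple (h : IsPicardVessiotRing σK A R σ) : IsDifferenceSimple σ :=
  ⟨h.nontrivial, h.simple⟩

theorem isDifferenceAlgebra (h : IsPicardVessiotRing σK A R σ) : IsDifferenceAlgebra σK σ :=
  h.map_algebraMap

theorem finiteType (h : IsPicardVessiotRing σK A R σ) : Algebra.FiniteType K R := by
  obtain ⟨Z, -, hZ⟩ := h.exists_fundamental
  have hfin : {z : R | ∃ i j, z = (Z : Matrix (Fin n) (Fin n) R) i j}.Finite := by
    simpa only [Set.range, Prod.exists, eq_comm] using
      Set.finite_range fun p : Fin n × Fin n => (Z : Matrix (Fin n) (Fin n) R) p.1 p.2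
  exact ⟨Subalgebra.fg_def.2 ⟨_, hfin.insert _, hZ⟩⟩

end

section Compositum

variable {R₁ R₂ : Type*} [CommRing R₁] [CommRing R₂] [Algebra K R₁] [Algebra K R₂]
  {σ₁ : R₁ ≃+* R₁} {σ₂ : R₂ ≃+* R₂}

theorem algebraMap_mem_adjoin_fixed {S : Type*} [CommRing S] [Algebra K S] [Algebra R₁ S]
    [Algebra R₂ S] [IsScalarTower K R₁ S] [IsScalarTower K R₂ S] {τ : S ≃+* S}
    (h₁ : IsPicardVessiotRing σK A R₁ σ₁) (h₂ : IsPicardVessiotRing σK A R₂ σ₂)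
    (hτ₁ : IsDifferenceAlgebra σ₁ τ) (hτ₂ : IsDifferenceAlgebra σ₂ τ) (r : R₂) :
    algebraMap R₂ S r ∈ Algebra.adjoin R₁ {s : S | τ s = s} := by
  obtain ⟨Z₁, hZ₁, -⟩ := h₁.exists_fundamental
  obtain ⟨Z₂, hZ₂, hgen⟩ := h₂.exists_fundamental
  let Y₁ := Matrix.GeneralLinearGroup.map (n := Fin n) (algebraMap R₁ S) Z₁
  let Y₂ := Matrix.GeneralLinearGroup.map (n := Fin n) (algebraMap R₂ S) Z₂
  let U := Y₁⁻¹ * Y₂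
  have hU : Matrix.GeneralLinearGroup.map (τ : S →+* S) U = U := by
    rw [map_mul, map_inv, hτ₁.map_fundamental hZ₁, hτ₂.map_fundamental hZ₂, mul_inv_rev,
      mul_assoc, inv_mul_cancel_left]
  have hYU : Y₂ = Y₁ * U := (mul_inv_cancel_left Y₁ Y₂).symm
  have hfixed (s : S) (hs : τ s = s) : s ∈ Algebra.adjoin R₁ {s : S | τ s = s} :=
    Algebra.subset_adjoin hs
  suffices hle : Algebra.adjoin K _ ≤ Subalgebra.comap (IsScalarTower.toAlgHom K R₂ S)
      ((Algebra.adjoin R₁ {s : S | τ s = s}).restrictScalars K) from hle (hgen ▸ Algebra.mem_top)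
  refine Algebra.adjoin_le ?_
  rintro z (rfl | ⟨i, j, rfl⟩)
  · have hdet : (Y₂⁻¹.det : S) = (U⁻¹.det : S) * (Y₁⁻¹.det : S) := by
      rw [hYU, mul_inv_rev, map_mul, Units.val_mul]
    have hdetU : τ (U⁻¹.det : S) = (U⁻¹.det : S) := by
      rw [← RingEquiv.coe_toRingHom, ← val_det_inv_map, hU]
    change algebraMap R₂ S _ ∈ Algebra.adjoin R₁ {s : S | τ s = s}
    rw [← val_det_inv_map, hdet, val_det_inv_map]
    exact mul_mem (hfixed _ hdetU) (Subalgebra.algebraMap_mem _ _)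
  · change (Y₂ : Matrix (Fin n) (Fin n) S) i j ∈ Algebra.adjoin R₁ {s : S | τ s = s}
    rw [hYU, Units.val_mul, Matrix.mul_apply]
    exact Subalgebra.sum_mem _ fun k _ => mul_mem (Subalgebra.algebraMap_mem _ (Z₁.val i k))
      (hfixed _ ((Matrix.GeneralLinearGroup.ext_iff _ _).1 hU k j))

theorem span_fixed_eq_top {S : Type*} [CommRing S] [Algebra K S] [Algebra R₁ S]
    [Algebra R₂ S] [IsScalarTower K R₁ S] [IsScalarTower K R₂ S] {τ : S ≃+* S}
    (h₁ : IsPicardVessiotRing σK A R₁ σ₁) (h₂ : IsPicardVessiotRing σK A R₂ σ₂)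
    (hτ₁ : IsDifferenceAlgebra σ₁ τ) (hτ₂ : IsDifferenceAlgebra σ₂ τ)
    (hgen : (algebraMap R₁ S).range ⊔ (algebraMap R₂ S).range = ⊤) :
    Submodule.span R₁ {s | τ s = s} = ⊤ := by
  have hle : (⊤ : Subring S) ≤ (Algebra.adjoin R₁ {s | τ s = s}).toSubring := by
    rw [← hgen, sup_le_iff]
    constructor
    · rintro _ ⟨r, rfl⟩
      exact Subalgebra.algebraMap_mem _ r
    · rintro _ ⟨r, rfl⟩
      exact h₁.algebraMap_mem_adjoin_fixed h₂ hτ₁ hτ₂ r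
  rw [← toSubmodule_adjoin_fixed, eq_top_iff]
  exact fun _ _ => hle trivial

theorem ringKrullDim_eq_and_finrank_periodicSubmodule_eq (h₁ : IsPicardVessiotRing σK A R₁ σ₁)
    (h₂ : IsPicardVessiotRing σK A R₂ σ₂) :
    ringKrullDim R₁ = ringKrullDim R₂ ∧
      Module.finrank (constantSubring σ₁) (periodicSubmodule σ₁) =
        Module.finrank (constantSubring σ₂) (periodicSubmodule σ₂) := by
  have := h₁.finiteType
  have := h₂.finiteType
  have := h₁.nontrivial
  have := h₂.nontrivial
  obtain ⟨S, _, _, _, _, τ, _, _, _, hτ, hτ₁, hτ₂, hgen⟩ :=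
    exists_isDifferenceSimple_compositum h₁.isDifferenceAlgebra h₂.isDifferenceAlgebra
  have := hτ.nontrivial
  have hspan₁ := h₁.span_fixed_eq_top h₂ hτ₁ hτ₂ hgen
  have hspan₂ := h₂.span_fixed_eq_top h₁ hτ₂ hτ₁ ((sup_comm _ _).trans hgen)
  have hK := h₁.isDifferenceAlgebra.trans hτ₁
  constructor
  · exact (hτ.ringKrullDim_eq h₁.isDifferenceSimple hK hτ₁ hspan₁).symm.trans
      (hτ.ringKrullDim_eq h₂.isDifferenceSimple hK hτ₂ hspan₂)
  · exact (h₁.isDifferenceSimple.finrank_periodicSubmodule_eq hτ₁ hspan₁).symm.trans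
      (h₂.isDifferenceSimple.finrank_periodicSubmodule_eq hτ₂ hspan₂)

end Compositum

end IsPicardVessiotRing

theorem proposition4p9_general {K : Type*} [Field K] (σK : K ≃+* K)
    (hK : constantField σK = periodicField σK)
    {n : ℕ} (A : Matrix.GeneralLinearGroup (Fin n) K)
    (R₁ : Type*) [CommRing R₁] [Algebra K R₁] (σ₁ : R₁ ≃+* R₁)
    (h₁ : IsPicardVessiotRing σK A R₁ σ₁)
    (R₂ : Type*) [CommRing R₂] [Algebra K R₂] (σ₂ : R₂ ≃+* R₂)
    (h₂ : IsPicardVessiotRing σK A R₂ σ₂) :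
    ringKrullDim R₁ = ringKrullDim R₂ ∧
      ∃ m : ℕ, HasMInvariant σK R₁ σ₁ m ∧ HasMInvariant σK R₂ σ₂ m := by
  have := h₁.finiteType
  have := h₂.finiteType
  obtain ⟨hdim, hrank⟩ := h₁.ringKrullDim_eq_and_finrank_periodicSubmodule_eq h₂
  have hm₁ := h₁.isDifferenceSimple.hasMInvariant_finrank h₁.isDifferenceAlgebra hK.ge
  have hm₂ := h₂.isDifferenceSimple.hasMInvariant_finrank h₂.isDifferenceAlgebra hK.ge
  exact ⟨hdim, _, hm₁, hrank ▸ hm₂⟩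

theorem proposition4p9 {K : Type*} [Field K] [CharZero K] (σK : K ≃+* K)
    (hK : constantField σK = periodicField σK)
    {n : ℕ} (A : Matrix.GeneralLinearGroup (Fin n) K)
    (R₁ : Type*) [CommRing R₁] [Algebra K R₁] (σ₁ : R₁ ≃+* R₁)
    (h₁ : IsPicardVessiotRing σK A R₁ σ₁)
    (R₂ : Type*) [CommRing R₂] [Algebra K R₂] (σ₂ : R₂ ≃+* R₂)
    (h₂ : IsPicardVessiotRing σK A R₂ σ₂) :
    ringKrullDim R₁ = ringKrullDim R₂ ∧
      ∃ m : ℕ, HasMInvariant σK R₁ σ₁ m ∧ HasMInvariant σK R₂ σ₂ m :=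
  proposition4p9_general σK hK A R₁ σ₁ h₁ R₂ σ₂ h₂
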